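/- A family $\mathcal F$ of subsets of a finite set is $t$-uniform if every member of $\mathcal F$ has exactly $t$ elements. A sunflower with $s$ petals is a collection of $s$ distinct sets $F_1,\dots,F_s$ such that $F_i\cap F_j=\bigcap_{u=1}^s F_u$ for all distinct $i,j\in\{1,\dots,s\}$. Let $s\ge 1$ and $t\ge 2$ be integers. Then the maximum $\phi(s,t)$ of $|\mathcal F|$, over all finite sets $X$ and all $t$-uniform families $\mathcal F$ of subsets of $X$ that contain no sunflower with $s$ petals, exists, and $$\phi(s,t)\le\left(2^{14}\,s\,\log t\right)^t,$$ where $\log$ is the natural logarithm (in particular, the same bound holds with $\log_2 t$ in place of $\log t$). -/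

import Mathlib

/-- `s` distinct sets `F 0, …, F (s - 1)` form a sunflower with `s` petals if any two of them
meet exactly in the common intersection (the core) of all of them. -/
def IsSunflower {α : Type*} {s : ℕ} (F : Fin s → Finset α) : Prop :=
  Function.Injective F ∧
    ∀ i j : Fin s, i ≠ j → (F i : Set α) ∩ (F j : Set α) = ⋂ u : Fin s, (F u : Set α)

/-- The family `𝓕` contains no sunflower with `s` petals (with a core of any size). -/
def SunflowerFree {α : Type*} (s : ℕ) (𝓕 : Finset (Finset α)) : Prop :=
  ¬ ∃ F : Fin s → Finset α, (∀ i, F i ∈ 𝓕) ∧ IsSunflower F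

/-- The family `𝓕` is `t`-uniform: all its members have exactly `t` elements. -/
def IsUniformFamily {α : Type*} (t : ℕ) (𝓕 : Finset (Finset α)) : Prop :=
  ∀ A ∈ 𝓕, A.card = t

/-- The sizes of the `t`-uniform families, on an arbitrary finite ground set `[n]`, that contain no
sunflower with `s` petals. -/
def sunflowerFreeSizes (s t : ℕ) : Set ℕ :=
  {N | ∃ (n : ℕ) (𝓕 : Finset (Finset (Fin n))),
    IsUniformFamily t 𝓕 ∧ SunflowerFree s 𝓕 ∧ 𝓕.card = N}

/-- `φ(s, t)`: the maximum size of a `t`-uniform family that contains no sunflower with `s` petals.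
The maximum is written as a supremum in `ℕ`. -/
noncomputable def sunflowerPhi (s t : ℕ) : ℕ :=
  sSup (sunflowerFreeSizes s t)

open Finset

/-! If `R ^ t < |𝓕|`, take `Z` maximizing `|{A ∈ 𝓕 : Z ⊆ A}| * R ^ |Z|`. The link of `Z` is then
`R`-spread, and `s` disjoint members of it, each joined with `Z`, form a sunflower with core `Z`.

To find them, colour the points at random with `2s` blocks of `L` colours, where `t < 2 ^ L`. Each
block contains all the colours of some member with probability at least 2/3, so some colouring makes
at least `s` blocks good, and distinct blocks give disjoint members.

For a single block, reveal its colours one by one. The part of a suitable member still uncovered,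
kept inside a random member `A`, halves at each step until it is empty. Failures are counted by
encoding: recolouring the uncovered set `T` loses little information, while `T ⊆ A` is rare by
spreadness. -/

/-- The elements whose colour under `c` lies in `P`. -/
def colourSet {α β : Type*} [Fintype α] [DecidableEq β] (P : Finset β) (c : α → β) : Finset α :=
  univ.filter fun x => c x ∈ P

/-- Some member of `G` has, outside the colours `P`, at most `k` elements, all of them in `A`. -/
def HasFragment {α β : Type*} [Fintype α] [DecidableEq α] [DecidableEq β]
    (G : Finset (Finset α)) (P : Finset β) (k : ℕ) (A : Finset α) (c : α → β) : Prop :=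
  ∃ B ∈ G, B \ colourSet P c ⊆ A ∧ (B \ colourSet P c).card ≤ k

/-- `G` is `R`-spread: every `Z` lies in at most a proportion `R ^ (-|Z|)` of its members. -/
def IsSpread {α : Type*} [DecidableEq α] (R : ℝ) (G : Finset (Finset α)) : Prop :=
  ∀ Z : Finset α, ((G.filter fun A => Z ⊆ A).card : ℝ) * R ^ Z.card ≤ G.card

/-! ### Recolouring and the cost of one colour -/

theorem card_agree_off {α β : Type*} [Fintype α] [DecidableEq α] [Fintype β] [DecidableEq β]
    (T : Finset α) (c' : α → β) :
    (univ.filter fun c : α → β => ∀ x ∉ T, c x = c' x).card = Fintype.card β ^ T.card := by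
  have h : (univ.filter fun c : α → β => ∀ x ∉ T, c x = c' x) =
      Fintype.piFinset fun x => if x ∈ T then univ else {c' x} := by
    ext c
    simp only [mem_filter, mem_univ, true_and, Fintype.mem_piFinset]
    refine forall_congr' fun x => ?_
    by_cases hx : x ∈ T <;> simp [hx]
  rw [h, Fintype.card_piFinset]
  have h2 : ∀ x, (if x ∈ T then (univ : Finset β) else {c' x}).card =
      if x ∈ T then Fintype.card β else 1 := by
    intro x; split_ifs <;> simp
  simp only [h2, prod_ite, prod_const_one, mul_one, prod_const]
  simp

/-- A pair losing its small fragment when the colour `b` is added is recovered from the recoloured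
function `c'` and the set `T` that was recoloured: `T` lies in a set that depends on `c'` only. -/
theorem exists_recolouring {α β : Type*} [Fintype α] [DecidableEq α] [DecidableEq β]
    (G : Finset (Finset α)) (P : Finset β) (b : β) (hb : b ∉ P) (k l : ℕ) :
    ∃ S : (α → β) → Finset α, (∀ c, (S c).card ≤ k) ∧ ∀ A c, HasFragment G P k A c →
      ¬ HasFragment G (insert b P) l A c → ∃ c', ∃ T ⊆ S c', l + 1 ≤ T.card ∧ T ⊆ A ∧
        ∀ x ∉ T, c x = c' x := by
  classical
  let Q : (α → β) → Finset α → Prop := fun c B =>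
    B ∈ G ∧ (B \ colourSet P c).card ≤ k ∧ B ⊆ colourSet (insert b P) c
  refine ⟨fun c => if h : ∃ B, Q c B then h.choose \ colourSet P c else ∅, fun c => ?_, ?_⟩
  · dsimp only
    split_ifs with h
    · exact h.choose_spec.2.1
    · simp
  intro A c hP hbP
  have hmono : ∀ c : α → β, colourSet P c ⊆ colourSet (insert b P) c := by
    intro c x; simp only [colourSet, mem_filter, mem_univ, true_and, mem_insert]; tauto
  let C := G.filter fun B => B \ colourSet (insert b P) c ⊆ A ∧ (B \ colourSet P c).card ≤ k
  have hC : C.Nonempty := by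
    obtain ⟨B, hB, h1, h2⟩ := hP
    exact ⟨B, mem_filter.2 ⟨hB, (sdiff_subset_sdiff subset_rfl (hmono c)).trans h1, h2⟩⟩
  -- Minimality makes decoding possible: any member covered under `c'` leaves a subset of `T`
  -- uncovered under `c`, hence exactly `T`, so the choice made from `c'` alone still contains `T`.
  obtain ⟨B, hB, hmin⟩ := exists_min_image C (fun B => (B \ colourSet (insert b P) c).card) hC
  obtain ⟨hBG, hBA, hBk⟩ := mem_filter.1 hB
  set T := B \ colourSet (insert b P) c with hT
  let c' : α → β := fun x => if x ∈ T then b else c x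
  have hTc : ∀ x ∈ T, c x ≠ b ∧ c x ∉ P := by
    intro x hx
    have := (mem_sdiff.1 hx).2
    simpa [colourSet] using this
  have e1 : colourSet P c' = colourSet P c := by
    ext x
    simp only [colourSet, mem_filter, mem_univ, true_and, c']
    by_cases hx : x ∈ T
    · simp [hx, hb, (hTc x hx).2]
    · simp [hx]
  have e2 : colourSet (insert b P) c' = colourSet (insert b P) c ∪ T := by
    ext x
    simp only [colourSet, mem_filter, mem_univ, true_and, c', mem_union]
    by_cases hx : x ∈ T
    · simp [hx]
    · simp [hx]
  have hex : ∃ B, Q c' B := by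
    refine ⟨B, hBG, by rwa [e1], ?_⟩
    rw [e2, hT]
    intro x hx
    by_cases h : x ∈ colourSet (insert b P) c <;> simp [h, hx]
  refine ⟨c', T, ?_, ?_, hBA, fun x hx => by simp [c', hx]⟩
  · simp only [hex, dite_true]
    obtain ⟨h1, h2, h3⟩ := hex.choose_spec
    set D := hex.choose
    rw [e1] at h2 ⊢
    rw [e2] at h3
    have hDT : D \ colourSet (insert b P) c ⊆ T := by
      intro x hx
      obtain ⟨hx1, hx2⟩ := mem_sdiff.1 hx
      exact (mem_union.1 (h3 hx1)).resolve_left hx2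
    have hle := hmin D (mem_filter.2 ⟨h1, hDT.trans hBA, h2⟩)
    rw [← eq_of_subset_of_card_le hDT hle]
    exact sdiff_subset_sdiff subset_rfl (hmono c)
  · by_contra hlt
    exact hbP ⟨B, hBG, hBA, Nat.lt_succ_iff.1 (not_le.1 hlt)⟩

-- Count the codes: for each `c'` there are at most `2 ^ k` sets `T`; each admits at most `|G| * R ^
-- (-|T|)` sets `A` and `(q * R) ^ |T|` colourings `c`. The powers of `R` cancel, leaving `q ^ |T|`
-- with `|T| ≥ l + 1`.
open Classical in
theorem card_lose_fragment_le {α β : Type*} [Fintype α] [DecidableEq α] [Fintype β] [DecidableEq β]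
    (G : Finset (Finset α)) {R q : ℝ} (hR : 0 < R) (hG : IsSpread R G) (hq : q ≤ 1)
    (hβ : (Fintype.card β : ℝ) = q * R) (P : Finset β) (b : β) (hb : b ∉ P) (k l : ℕ) :
    (((G ×ˢ (univ : Finset (α → β))).filter fun p =>
      HasFragment G P k p.1 p.2 ∧ ¬ HasFragment G (insert b P) l p.1 p.2).card : ℝ) ≤
      G.card * Fintype.card (α → β) * (2 ^ k * q ^ (l + 1)) := by
  have hq0 : 0 ≤ q := by
    by_contra! h
    have : q * R < 0 := mul_neg_of_neg_of_pos h hR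
    have : (0 : ℝ) ≤ Fintype.card β := by positivity
    linarith
  obtain ⟨S, hS, hrec⟩ := exists_recolouring G P b hb k l
  let Ts : (α → β) → Finset (Finset α) := fun c' =>
    (S c').powerset.filter fun T => l + 1 ≤ T.card
  let E : (α → β) → Finset α → Finset (Finset α × (α → β)) := fun c' T =>
    (G.filter fun A => T ⊆ A) ×ˢ (univ.filter fun c : α → β => ∀ x ∉ T, c x = c' x)
  have hsub : ((G ×ˢ (univ : Finset (α → β))).filter fun p =>
      HasFragment G P k p.1 p.2 ∧ ¬ HasFragment G (insert b P) l p.1 p.2) ⊆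
      univ.biUnion fun c' => (Ts c').biUnion (E c') := by
    rintro ⟨A, c⟩ h
    simp only [mem_filter, mem_product, mem_univ, and_true] at h
    obtain ⟨c', T, h1, h2, h3, h4⟩ := hrec A c h.2.1 h.2.2
    simp only [mem_biUnion, mem_univ, true_and, Ts, E, mem_filter, mem_powerset, mem_product]
    exact ⟨c', T, ⟨h1, h2⟩, ⟨h.1, h3⟩, h4⟩
  have hE : ∀ c', ∀ T ∈ Ts c', ((E c' T).card : ℝ) ≤ G.card * q ^ (l + 1) := by
    intro c' T hT
    have hTl : l + 1 ≤ T.card := (mem_filter.1 hT).2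
    have := hG T
    simp only [E, card_product, card_agree_off, Nat.cast_mul, Nat.cast_pow, hβ, mul_pow]
    calc _ = (((G.filter fun A => T ⊆ A).card : ℝ) * R ^ T.card) * q ^ T.card := by
            ring
      _ ≤ G.card * q ^ (l + 1) :=
        mul_le_mul (by convert this) (pow_le_pow_of_le_one hq0 hq hTl) (by positivity) (by positivity)
  have hTs : ∀ c', ((Ts c').card : ℝ) ≤ 2 ^ k := by
    intro c'
    have h1 : (Ts c').card ≤ 2 ^ (S c').card :=
      (card_filter_le _ _).trans (card_powerset _).le
    exact_mod_cast h1.trans (Nat.pow_le_pow_right (by norm_num) (hS c'))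
  calc _ ≤ ((univ.biUnion fun c' => (Ts c').biUnion (E c')).card : ℝ) := by
        exact_mod_cast card_le_card hsub
    _ ≤ ∑ c' : α → β, (((Ts c').biUnion (E c')).card : ℝ) := by exact_mod_cast card_biUnion_le
    _ ≤ ∑ c' : α → β, ∑ T ∈ Ts c', ((E c' T).card : ℝ) :=
        sum_le_sum fun c' _ => by exact_mod_cast card_biUnion_le
    _ ≤ ∑ c' : α → β, 2 ^ k * (G.card * q ^ (l + 1)) := by
        refine sum_le_sum fun c' _ => (sum_le_card_nsmul _ _ _ (hE c')).trans ?_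
        rw [nsmul_eq_mul]
        exact mul_le_mul_of_nonneg_right (hTs c') (by positivity)
    _ = _ := by rw [sum_const, nsmul_eq_mul, card_univ]; ring

/-! ### Halving the fragment down to the empty set -/

open Classical in
theorem card_not_hasFragment_le {α β : Type*} [Fintype α] [DecidableEq α] [Fintype β] [DecidableEq β]
    (G : Finset (Finset α)) {R q : ℝ} (hR : 0 < R) (hG : IsSpread R G) (hq0 : 0 ≤ q)
    (hq : q ≤ 1 / 16) (hβ : (Fintype.card β : ℝ) = q * R) {L : ℕ} (hL : ∀ A ∈ G, A.card < 2 ^ L)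
    (e : Fin L → β) (he : Function.Injective e) {i : ℕ} (hi : i ≤ L) :
    (((G ×ˢ (univ : Finset (α → β))).filter fun p => ¬ HasFragment G
      ((univ.filter fun j : Fin L => j.val < i).image e) (2 ^ (L - i) - 1) p.1 p.2).card : ℝ) ≤
      G.card * Fintype.card (α → β) * (1 / 3 * (1 / 4) ^ (L - i)) := by
  induction i with
  | zero =>
    rw [filter_false_of_mem]
    · simp only [card_empty, Nat.cast_zero]; positivity
    · rintro ⟨A, c⟩ hA
      have hA : A ∈ G := (mem_product.1 hA).1
      have := hL A hA
      refine not_not.2 ⟨A, hA, sdiff_subset, (card_le_card sdiff_subset).trans ?_⟩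
      rw [Nat.sub_zero]; omega
  | succ i ih =>
    have ih := ih (by omega)
    set P := (univ.filter fun j : Fin L => j.val < i).image e with hP
    have hP' : (univ.filter fun j : Fin L => j.val < i + 1).image e = insert (e ⟨i, hi⟩) P := by
      rw [hP, ← image_insert]
      congr 1
      ext j
      simp only [mem_filter, mem_univ, true_and, mem_insert, Fin.ext_iff]
      omega
    have hb : e ⟨i, hi⟩ ∉ P := by
      simp only [hP, mem_image, mem_filter, mem_univ, true_and, not_exists, not_and]
      intro j hj h
      have := congrArg Fin.val (he h)
      simp at this
      omega
    rw [hP']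
    obtain ⟨d, rfl⟩ : ∃ d, L = i + 1 + d := ⟨L - (i + 1), by omega⟩
    have h1 : i + 1 + d - i = d + 1 := by omega
    have h2 : i + 1 + d - (i + 1) = d := by omega
    rw [h1] at ih
    rw [h2]
    have hstep := card_lose_fragment_le G hR hG (hq.trans (by norm_num)) hβ P _ hb
      (2 ^ (d + 1) - 1) (2 ^ d - 1)
    have hpos : 1 ≤ 2 ^ d := Nat.one_le_two_pow
    rw [Nat.sub_add_cancel hpos] at hstep
    -- Since `2 ^ (d + 1) = 2 * 2 ^ d`, the encoding cost merges into `(4 * q) ^ 2 ^ d`, and `4 * q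
    -- ≤ 1 / 4`. The errors then sum as a geometric series of ratio 4, whence the factor `1 / 3`.
    have hnum : (2 : ℝ) ^ (2 ^ (d + 1) - 1) * q ^ 2 ^ d ≤ (1 / 4) ^ (d + 1) := by
      calc (2 : ℝ) ^ (2 ^ (d + 1) - 1) * q ^ 2 ^ d ≤ 2 ^ (2 ^ (d + 1)) * q ^ 2 ^ d := by
            gcongr
            · norm_num
            · omega
        _ = (4 * q) ^ 2 ^ d := by
            rw [pow_succ' 2 d, pow_mul, mul_pow]; norm_num
        _ ≤ (1 / 4) ^ 2 ^ d := by gcongr; linarith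
        _ ≤ (1 / 4) ^ (d + 1) :=
            pow_le_pow_of_le_one (by norm_num) (by norm_num) Nat.lt_two_pow_self
    have hsub : ((G ×ˢ (univ : Finset (α → β))).filter fun p =>
          ¬ HasFragment G (insert (e ⟨i, hi⟩) P) (2 ^ d - 1) p.1 p.2) ⊆
        ((G ×ˢ univ).filter fun p => ¬ HasFragment G P (2 ^ (d + 1) - 1) p.1 p.2) ∪
        ((G ×ˢ univ).filter fun p => HasFragment G P (2 ^ (d + 1) - 1) p.1 p.2 ∧
          ¬ HasFragment G (insert (e ⟨i, hi⟩) P) (2 ^ d - 1) p.1 p.2) := by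
      intro p hp
      simp only [mem_union, mem_filter] at hp ⊢
      tauto
    have hcard := (card_le_card hsub).trans (card_union_le _ _)
    have hcard' : (_ : ℝ) ≤ _ := Nat.cast_le.2 hcard
    rw [Nat.cast_add] at hcard'
    refine hcard'.trans ((add_le_add ih (hstep.trans
      (mul_le_mul_of_nonneg_left hnum (by positivity)))).trans (le_of_eq ?_))
    rw [pow_succ]; ring

open Classical in
/-- In a spread family, most colourings put a member of the family into the colours `e`. -/
theorem card_no_member_le {α β : Type*} [Fintype α] [DecidableEq α] [Fintype β] [DecidableEq β]
    (G : Finset (Finset α)) (hne : G.Nonempty) {R q : ℝ} (hR : 0 < R) (hG : IsSpread R G)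
    (hq0 : 0 ≤ q) (hq : q ≤ 1 / 16) (hβ : (Fintype.card β : ℝ) = q * R) {L : ℕ}
    (hL : ∀ A ∈ G, A.card < 2 ^ L) (e : Fin L → β) (he : Function.Injective e) :
    ((univ.filter fun c : α → β => ¬ ∃ B ∈ G, ∀ x ∈ B, c x ∈ Set.range e).card : ℝ) ≤
      Fintype.card (α → β) / 3 := by
  have h := card_not_hasFragment_le G hR hG hq0 hq hβ hL e he le_rfl
  have hsub : G ×ˢ (univ.filter fun c : α → β => ¬ ∃ B ∈ G, ∀ x ∈ B, c x ∈ Set.range e) ⊆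
      ((G ×ˢ (univ : Finset (α → β))).filter fun p => ¬ HasFragment G
      ((univ.filter fun j : Fin L => j.val < L).image e) (2 ^ (L - L) - 1) p.1 p.2) := by
    rintro ⟨A, c⟩ hA
    simp only [mem_product, mem_filter, mem_univ, true_and, and_true] at hA ⊢
    refine ⟨hA.1, ?_⟩
    rintro ⟨B, hB, -, h0⟩
    refine hA.2 ⟨B, hB, fun x hx => ?_⟩
    have h0 : B \ colourSet ((univ.filter fun j : Fin L => j.val < L).image e) c = ∅ := by
      simpa using h0
    have := (sdiff_eq_empty_iff_subset.1 h0) hx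
    simpa [colourSet] using this
  have hcard : (_ : ℝ) ≤ _ := Nat.cast_le.2 (card_le_card hsub)
  rw [card_product, Nat.cast_mul] at hcard
  have hpos : (0 : ℝ) < G.card := by exact_mod_cast hne.card_pos
  have := hcard.trans h
  rw [mul_assoc] at this
  have := le_of_mul_le_mul_left this hpos
  refine (le_of_eq ?_).trans (this.trans (le_of_eq ?_))
  · congr!
  · rw [Nat.sub_self, pow_zero, mul_one, mul_one_div]

/-! ### Disjoint members of a spread family -/

/-- A spread family of small sets has `s` pairwise disjoint members. -/
theorem IsSpread.exists_pairwise_disjoint {α : Type*} [Fintype α] [DecidableEq α]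
    {G : Finset (Finset α)} {R : ℝ} (hG : IsSpread R G) (hne : G.Nonempty) (hR : 0 < R) {L s : ℕ}
    (hs : 1 ≤ s) (hL0 : 0 < L) (hL : ∀ A ∈ G, A.card < 2 ^ L) (hR' : 32 * (s * L : ℝ) ≤ R) :
    ∃ B : Fin s → Finset α, (∀ i, B i ∈ G) ∧ ∀ i j, i ≠ j → Disjoint (B i) (B j) := by
  classical
  let β := Fin (2 * s) × Fin L
  let bad : Fin (2 * s) → (α → β) → Prop := fun j c =>
    ¬ ∃ B ∈ G, ∀ x ∈ B, c x ∈ Set.range fun l : Fin L => (j, l)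
  have hβ : (Fintype.card β : ℝ) = (2 * s * L) / R * R := by
    rw [div_mul_cancel₀ _ hR.ne']; simp [β]
  have hbad : ∀ j, ((univ.filter fun c => bad j c).card : ℝ) ≤ Fintype.card (α → β) / 3 := by
    intro j
    have hq : (2 * s * L : ℝ) / R ≤ 1 / 16 := by rw [div_le_iff₀ hR]; linarith
    exact card_no_member_le G hne hR hG (by positivity) hq hβ hL (fun l => (j, l))
      fun a b h => (Prod.ext_iff.1 h).2
  -- The average number of bad blocks is at most `2s / 3`, so not every colouring can have `s + 1`
  -- of them.
  obtain ⟨c, hc⟩ : ∃ c : α → β, s ≤ (univ.filter fun j => ¬ bad j c).card := by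
    by_contra! hlt
    have h1 : ∀ c : α → β, s + 1 ≤ (univ.filter fun j => bad j c).card := by
      intro c
      have h2 := card_filter_add_card_filter_not (s := (univ : Finset (Fin (2 * s))))
        (fun j => bad j c)
      have h3 := hlt c
      simp only [card_univ, Fintype.card_fin] at h2
      omega
    have h4 : Fintype.card (α → β) * (s + 1) ≤ ∑ j, (univ.filter fun c => bad j c).card := by
      simp only [card_filter] at h1 ⊢
      rw [sum_comm]
      calc _ = ∑ c : α → β, (s + 1) := by simp
        _ ≤ _ := sum_le_sum fun c _ => h1 c
    have h5 : (Fintype.card (α → β) : ℝ) * (s + 1) ≤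
        2 * s * (Fintype.card (α → β) / 3) := by
      calc _ ≤ ((∑ j, (univ.filter fun c => bad j c).card : ℕ) : ℝ) := by exact_mod_cast h4
        _ ≤ ∑ j : Fin (2 * s), (Fintype.card (α → β) / 3 : ℝ) := by
            rw [Nat.cast_sum]; exact sum_le_sum fun j _ => hbad j
        _ = _ := by simp
    have h6 : (0 : ℝ) < Fintype.card (α → β) := by
      have : Nonempty β := ⟨(⟨0, by omega⟩, ⟨0, hL0⟩)⟩
      exact_mod_cast Fintype.card_pos
    nlinarith [(Nat.cast_nonneg s : (0 : ℝ) ≤ s)]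
  obtain ⟨J, hJsub, hJ⟩ := exists_subset_card_eq hc
  let f : Fin s → Fin (2 * s) := fun i => J.orderEmbOfFin hJ i
  have hf : Function.Injective f := (J.orderEmbOfFin hJ).injective
  have hgood : ∀ i, ∃ B ∈ G, ∀ x ∈ B, c x ∈ Set.range fun l : Fin L => (f i, l) := by
    intro i
    have := hJsub (J.orderEmbOfFin_mem hJ i)
    exact not_not.1 (mem_filter.1 this).2
  choose B hB hBc using hgood
  refine ⟨B, hB, fun i j hij => disjoint_left.2 fun x hi hj => hij (hf ?_)⟩
  obtain ⟨l, hl⟩ := hBc i x hi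
  obtain ⟨l', hl'⟩ := hBc j x hj
  exact congrArg Prod.fst (hl.trans hl'.symm)

/-! ### Spread links and sunflowers -/

theorem exists_link_isSpread {α : Type*} [Fintype α] [DecidableEq α] (𝓕 : Finset (Finset α))
    {t : ℕ} (hu : IsUniformFamily t 𝓕) {R : ℝ} (hR : 0 < R) (hcard : R ^ t < 𝓕.card) :
    ∃ (Z : Finset α) (G : Finset (Finset α)), G.Nonempty ∧ IsSpread R G ∧
      ∀ B ∈ G, Disjoint Z B ∧ Z ∪ B ∈ 𝓕 ∧ B.Nonempty := by
  obtain ⟨Z, -, hZ⟩ := exists_max_image (univ : Finset (Finset α))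
    (fun Z => ((𝓕.filter fun A => Z ⊆ A).card : ℝ) * R ^ Z.card) univ_nonempty
  have h0 := hZ ∅ (mem_univ _)
  simp only [empty_subset, filter_true, card_empty, pow_zero, mul_one] at h0
  have hZt : R ^ t < ((𝓕.filter fun A => Z ⊆ A).card : ℝ) * R ^ Z.card := hcard.trans_le h0
  -- Only one member could contain a `Z` of size `t`, so its weight would not exceed `R ^ t`. Hence
  -- the link has no empty member, which later makes the petals distinct.
  have hZn : Z.card ≠ t := by
    intro h
    have h1 : (𝓕.filter fun A => Z ⊆ A) ⊆ {Z} := by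
      intro A hA
      obtain ⟨hA, hZA⟩ := mem_filter.1 hA
      exact mem_singleton.2 (eq_of_subset_of_card_le hZA (by rw [hu A hA, h])).symm
    have h2 : ((𝓕.filter fun A => Z ⊆ A).card : ℝ) ≤ 1 := by exact_mod_cast card_le_card h1
    rw [h] at hZt
    have : 0 < R ^ t := by positivity
    nlinarith
  have hinj : Set.InjOn (fun A : Finset α => A \ Z) (𝓕.filter fun A => Z ⊆ A) := by
    intro A hA B hB h
    have hA := (mem_filter.1 hA).2
    have hB := (mem_filter.1 hB).2
    rw [← sdiff_union_of_subset hA, ← sdiff_union_of_subset hB]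
    exact congrArg (· ∪ Z) h
  refine ⟨Z, (𝓕.filter fun A => Z ⊆ A).image fun A => A \ Z, ?_, ?_, ?_⟩
  · rw [image_nonempty, nonempty_iff_ne_empty]
    intro h
    rw [h] at hZt
    have : 0 < R ^ t := by positivity
    simp at hZt
    linarith
  · intro Y
    rw [card_image_of_injOn hinj]
    by_cases hY : Disjoint Y Z
    · have h1 := hZ (Y ∪ Z) (mem_univ _)
      rw [card_union_of_disjoint hY, pow_add, ← mul_assoc] at h1
      have h2 := le_of_mul_le_mul_right h1 (by positivity)
      refine le_trans (mul_le_mul_of_nonneg_right ?_ (by positivity)) h2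
      rw [Nat.cast_le]
      have h3 : ((𝓕.filter fun A => Z ⊆ A).image fun A => A \ Z).filter (fun A => Y ⊆ A) ⊆
          (𝓕.filter fun A => Y ∪ Z ⊆ A).image fun A => A \ Z := by
        intro B hB
        obtain ⟨hB, hYB⟩ := mem_filter.1 hB
        obtain ⟨A, hA, rfl⟩ := mem_image.1 hB
        obtain ⟨hA, hZA⟩ := mem_filter.1 hA
        exact mem_image.2 ⟨A, mem_filter.2
          ⟨hA, union_subset (hYB.trans sdiff_subset) hZA⟩, rfl⟩
      exact (card_le_card h3).trans card_image_le
    · rw [filter_false_of_mem]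
      · simp
      · intro B hB hYB
        obtain ⟨A, -, rfl⟩ := mem_image.1 hB
        exact hY (disjoint_of_subset_left hYB sdiff_disjoint)
  · intro B hB
    obtain ⟨A, hA, rfl⟩ := mem_image.1 hB
    obtain ⟨hA, hZA⟩ := mem_filter.1 hA
    refine ⟨disjoint_sdiff, by rwa [union_sdiff_of_subset hZA], ?_⟩
    rw [sdiff_nonempty]
    intro hAZ
    exact hZn (by rw [← hu A hA, subset_antisymm hAZ hZA])

theorem exists_isSunflower {α : Type*} [Fintype α] (𝓕 : Finset (Finset α))
    {t : ℕ} (hu : IsUniformFamily t 𝓕) {R : ℝ} {L s : ℕ} (hs : 1 ≤ s) (ht : t < 2 ^ L)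
    (hL : 0 < L) (hR : 32 * (s * L : ℝ) ≤ R) (hcard : R ^ t < 𝓕.card) :
    ∃ F : Fin s → Finset α, (∀ i, F i ∈ 𝓕) ∧ IsSunflower F := by
  classical
  have hR0 : 0 < R := lt_of_lt_of_le (by positivity) hR
  obtain ⟨Z, G, hne, hG, hmem⟩ := exists_link_isSpread 𝓕 hu hR0 hcard
  obtain ⟨B, hB, hdis⟩ := hG.exists_pairwise_disjoint hne hR0 hs hL (fun A hA => by
    have h1 := hu _ (hmem A hA).2.1
    have h2 : A.card ≤ (Z ∪ A).card := card_le_card subset_union_right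
    omega) hR
  refine ⟨fun i => Z ∪ B i, fun i => (hmem _ (hB i)).2.1, ?_, ?_⟩
  · intro i j h
    by_contra hij
    obtain ⟨x, hx⟩ := (hmem _ (hB i)).2.2
    have h1 : x ∈ Z ∪ B j := by
      rw [← show Z ∪ B i = Z ∪ B j from h]
      exact mem_union_right _ hx
    rcases mem_union.1 h1 with h2 | h2
    · exact disjoint_left.1 (hmem _ (hB i)).1 h2 hx
    · exact disjoint_left.1 (hdis i j hij) hx h2
  · intro i j hij
    refine Set.Subset.antisymm ?_ fun x hx => ⟨Set.mem_iInter.1 hx i, Set.mem_iInter.1 hx j⟩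
    rintro x ⟨h1, h2⟩
    have hZ : x ∈ Z := by
      rcases mem_union.1 (mem_coe.1 h1) with h1 | h1
      · exact h1
      rcases mem_union.1 (mem_coe.1 h2) with h2 | h2
      · exact h2
      exact (disjoint_left.1 (hdis i j hij) h1 h2).elim
    exact Set.mem_iInter.2 fun u => mem_coe.2 (mem_union_left _ hZ)

/-! ### The numerical bound -/

theorem SunflowerFree.card_le {n s t : ℕ} (hs : 1 ≤ s) (ht : 2 ≤ t)
    {𝓕 : Finset (Finset (Fin n))} (hu : IsUniformFamily t 𝓕) (hf : SunflowerFree s 𝓕) :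
    (𝓕.card : ℝ) ≤ ((2 : ℝ) ^ 14 * (s : ℝ) * Real.log (t : ℝ)) ^ t := by
  by_contra! h
  refine hf (exists_isSunflower 𝓕 hu hs (Nat.lt_pow_succ_log_self (b := 2) (by norm_num) t)
    (Nat.succ_pos _) ?_ h)
  have h1 : (Nat.log 2 t : ℝ) * Real.log 2 ≤ Real.log t := by
    rw [← Real.log_pow]
    apply Real.log_le_log (by positivity)
    exact_mod_cast Nat.pow_log_le_self 2 (by omega)
  have h2 : Real.log 2 ≤ Real.log t := Real.log_le_log (by norm_num) (by exact_mod_cast ht)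
  have h3 := Real.log_two_gt_d9
  -- With `L = Nat.log 2 t + 1` this gives `32 * s * L ≤ 2 ^ 7 * s * log t`, well below the allowed
  -- `2 ^ 14`.
  have h4 : (Nat.log 2 t : ℝ) + 1 ≤ 4 * Real.log t := by
    have : (0 : ℝ) ≤ Nat.log 2 t := by positivity
    nlinarith
  have hs0 : (0 : ℝ) ≤ s := by positivity
  have h5 := mul_le_mul_of_nonneg_left h4 hs0
  have h6 : 0 ≤ s * Real.log t := mul_nonneg hs0 (by linarith)
  push_cast
  linarith

theorem mainTheorem12 (s t : ℕ) (hs : 1 ≤ s) (ht : 2 ≤ t) :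
    IsGreatest (sunflowerFreeSizes s t) (sunflowerPhi s t) ∧
      (sunflowerPhi s t : ℝ) ≤ ((2 : ℝ) ^ 14 * (s : ℝ) * Real.log (t : ℝ)) ^ t := by
  have hle : ∀ N ∈ sunflowerFreeSizes s t,
      (N : ℝ) ≤ ((2 : ℝ) ^ 14 * (s : ℝ) * Real.log (t : ℝ)) ^ t := by
    rintro N ⟨n, 𝓕, hu, hf, rfl⟩
    exact hf.card_le hs ht hu
  have hbdd : BddAbove (sunflowerFreeSizes s t) :=
    ⟨_, fun N hN => Nat.le_floor (hle N hN)⟩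
  have hne : (sunflowerFreeSizes s t).Nonempty :=
    ⟨0, 0, ∅, by simp [IsUniformFamily],
      fun ⟨F, hF, _⟩ => by simpa using hF ⟨0, hs⟩, by simp⟩
  have hmem : sunflowerPhi s t ∈ sunflowerFreeSizes s t := Nat.sSup_mem hne hbdd
  exact ⟨⟨hmem, fun N hN => le_csSup hbdd hN⟩, hle _ hmem⟩
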